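/- For a compact Hausdorff space $X$, let $2^X$ be the hyperspace of all non-empty closed subsets of $X$ with the Vietoris topology, and let $\mathfrak{M}(X)$ be the space of all regular Borel probability measures on $X$ with the weak-$*$ topology; $\mathfrak{M}(X)$ is again a compact Hausdorff space. A map $f\colon X\to Y$ is *semi-open* if $f[U]$ has non-empty interior in $Y$ for every non-empty open set $U\subseteq X$. A continuous surjection $f\colon X\to Y$ of compact Hausdorff spaces is *densely open* if there is a dense set $Y_o\subseteq Y$ such that the map $f^{-1}\colon Y\to 2^X$, $y\mapsto f^{-1}(y)$, is continuous at each point of $Y_o$. **Theorem.** Let $f\colon X\to Y$ be a continuous surjection of compact Hausdorff spaces, and let $f_*\colon\mathfrak{M}(X)\to\mathfrak{M}(Y)$, $\mu\mapsto\mu\circ f^{-1}$, be the induced continuous surjection. Then: 1. If $f$ is semi-open and densely open, then $f_*$ is semi-open and densely open. 2. If $f$ is densely open, then $f_*$ is densely open. -/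

import Mathlib

open MeasureTheory

namespace InducedMaps

/-- A map is semi-open if the image of every non-empty open set has non-empty interior. -/
def SemiOpen {X Y : Type*} [TopologicalSpace X] [TopologicalSpace Y] (f : X → Y) : Prop :=
  ∀ U : Set X, IsOpen U → U.Nonempty → (interior (f '' U)).Nonempty

/-- The hyperspace `2^X`: the set of all non-empty closed subsets of `X`. -/
def Hyperspace (X : Type*) [TopologicalSpace X] : Type _ :=
  {K : Set X // K.Nonempty ∧ IsClosed K}

/-- The hyperspace carries the Vietoris topology, generated by the sets `{K | K ⊆ U}` and
`{K | (K ∩ U).Nonempty}` for `U` open in `X`. -/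
instance Hyperspace.instTopologicalSpace (X : Type*) [TopologicalSpace X] :
    TopologicalSpace (Hyperspace X) :=
  TopologicalSpace.induced (fun K : Hyperspace X => K.1) (TopologicalSpace.vietoris X)

/-- A continuous surjection `f : X → Y` is densely open if the fibre map `y ↦ f⁻¹(y)`, as a map
`F` from `Y` to the hyperspace of `X`, is continuous at each point of some dense subset of `Y`. -/
def DenselyOpen {X Y : Type*} [TopologicalSpace X] [TopologicalSpace Y] (f : X → Y) : Prop :=
  Continuous f ∧ Function.Surjective f ∧
    ∃ F : Y → Hyperspace X, (∀ y, (F y).1 = f ⁻¹' {y}) ∧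
      ∃ D : Set Y, Dense D ∧ ∀ y ∈ D, ContinuousAt F y

/-- The space `𝔐(X)` of regular Borel probability measures on `X`. -/
def RegProb (X : Type*) [TopologicalSpace X] [MeasurableSpace X] : Type _ :=
  {μ : ProbabilityMeasure X // (μ : Measure X).Regular}

/-- `𝔐(X)` carries the weak-* topology: the coarsest one making `μ ↦ ∫ g dμ` continuous for all
bounded continuous functions `g` on `X`. -/
noncomputable instance RegProb.instTopologicalSpace (X : Type*) [TopologicalSpace X] [MeasurableSpace X]
    [OpensMeasurableSpace X] :
    TopologicalSpace (RegProb X) :=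
  TopologicalSpace.induced (fun μ : RegProb X => μ.1) inferInstance

/-- The induced map `f_* : 𝔐(X) → 𝔐(Y)`, `μ ↦ μ ∘ f⁻¹`, of a continuous map of compact Hausdorff
spaces. -/
noncomputable def pushforward {X Y : Type*}
    [TopologicalSpace X] [CompactSpace X] [T2Space X] [MeasurableSpace X] [BorelSpace X]
    [TopologicalSpace Y] [CompactSpace Y] [T2Space Y] [MeasurableSpace Y] [BorelSpace Y]
    (f : X → Y) (hf : Continuous f) (μ : RegProb X) : RegProb Y :=
  ⟨μ.1.map hf.aemeasurable, by
    have hμ : (μ.1 : Measure X).Regular := μ.2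
    have h : ((μ.1 : Measure X).map f).InnerRegularCompactLTTop :=
      Measure.InnerRegularCompactLTTop.map_of_continuous hf
    have hp : IsProbabilityMeasure ((μ.1 : Measure X).map f) :=
      (μ.1 : Measure X).isProbabilityMeasure_map hf.aemeasurable
    rw [ProbabilityMeasure.toMeasure_map]
    infer_instance⟩

end InducedMaps

set_option linter.unusedSectionVars false

namespace InducedMaps

open Set Filter Topology TopologicalSpace

/-! ### Continuity of the fibre map. -/

section Fibres

/-! A continuous map of compact Hausdorff spaces is closed, so its fibre map is upper semicontinuous
and only lower semicontinuity (`FibreOpenAt`) matters. If it holds on a dense `D`, then `f_*` has it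
at every measure carried by a finite subset of `D`, and such measures are dense.

The core is `fibreOpenAt_pushforward`. Let `μ` lie over a finitely supported `ν`, and let `g` be a
vector of test functions. The means of `g` under `μ` over the atoms of `ν` lie nearly in the convex
hulls of `g` on those fibres; fibre-openness lets these values be followed along nearby fibres, and
Tietze extends them to a continuous `h` on `Y`. For finitely supported `ν'` near `ν`, gluing
measures on fibres with means close to `h` gives `μ'` over `ν'` close to `μ`. Compactness removes
the finite support of `ν'`.

If `f` is semi-open, `f⁻¹ D` is dense, so every open set of `𝔐(X)` contains a measure lying over
such a `ν`; hence `f_*` is semi-open. -/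

theorem fibre_inter_nonempty_iff {X Y : Type*} {f : X → Y} {y : Y} {U : Set X} :
    (f ⁻¹' {y} ∩ U).Nonempty ↔ y ∈ f '' U :=
  ⟨fun ⟨x, hx, hU⟩ => ⟨x, hU, hx⟩, fun ⟨x, hU, hx⟩ => ⟨x, hx, hU⟩⟩

variable {X Y : Type*} [TopologicalSpace X] [TopologicalSpace Y]

/-- A map is fibre-open at `y` if the image of every open set meeting the fibre over `y` is a
neighbourhood of `y`, i.e. if the fibre map is lower semicontinuous at `y`. -/
def FibreOpenAt (f : X → Y) (y : Y) : Prop :=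
  ∀ U : Set X, IsOpen U → (f ⁻¹' {y} ∩ U).Nonempty → f '' U ∈ 𝓝 y

theorem FibreOpenAt.of_continuousAt {f : X → Y} {F : Y → Hyperspace X}
    (hF : ∀ y, (F y).1 = f ⁻¹' {y}) {y : Y} (h : ContinuousAt F y) : FibreOpenAt f y := by
  intro U hU hne
  let _ := TopologicalSpace.vietoris X
  have hc : ContinuousAt (fun z => (F z).1) y := continuous_induced_dom.continuousAt.comp h
  have hV := hc.preimage_mem_nhds
    ((vietoris.isOpen_inter_nonempty_of_isOpen hU).mem_nhds (by simpa [hF] using hne))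
  filter_upwards [hV] with z hz
  have hz : ((F z).1 ∩ U).Nonempty := hz
  rwa [hF, fibre_inter_nonempty_iff] at hz

theorem FibreOpenAt.continuousAt {f : X → Y} (hcl : IsClosedMap f) {F : Y → Hyperspace X}
    (hF : ∀ y, (F y).1 = f ⁻¹' {y}) {y : Y} (h : FibreOpenAt f y) : ContinuousAt F y := by
  let _ := TopologicalSpace.vietoris X
  rw [ContinuousAt, nhds_induced, tendsto_comap_iff]
  refine tendsto_nhds_generateFrom_iff.2 ?_
  rintro _ (⟨U, hU, rfl⟩ | ⟨U, hU, rfl⟩) hy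
  · have hy : f ⁻¹' {y} ⊆ U := by simpa [hF] using hy
    have hU' : IsOpen (f '' Uᶜ)ᶜ := (hcl _ hU.isClosed_compl).isOpen_compl
    filter_upwards [hU'.mem_nhds (by
      rintro ⟨x, hx, rfl⟩
      exact hx (hy rfl))] with z hz
    change (F z).1 ⊆ U
    rw [hF]
    intro x hx
    by_contra hxU
    exact hz ⟨x, hxU, hx⟩
  · have hy : ((F y).1 ∩ U).Nonempty := hy
    rw [hF] at hy
    filter_upwards [h U hU hy] with z hz
    change ((F z).1 ∩ U).Nonempty
    rwa [hF, fibre_inter_nonempty_iff]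

theorem denselyOpen_of_dense_fibreOpenAt [CompactSpace X] [T2Space Y] {f : X → Y}
    (hf : Continuous f) (hs : Function.Surjective f) {D : Set Y} (hD : Dense D)
    (h : ∀ y ∈ D, FibreOpenAt f y) : DenselyOpen f :=
  ⟨hf, hs, fun y => ⟨f ⁻¹' {y}, hs y, isClosed_singleton.preimage hf⟩, fun _ => rfl, D, hD,
    fun y hy => (h y hy).continuousAt hf.isClosedMap fun _ => rfl⟩

theorem SemiOpen.dense_preimage {f : X → Y} (hf : SemiOpen f) {D : Set Y} (hD : Dense D) :
    Dense (f ⁻¹' D) := by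
  rw [dense_iff_inter_open]
  intro U hU hne
  obtain ⟨y, hy, hyD⟩ := hD.inter_open_nonempty _ isOpen_interior (hf U hU hne)
  obtain ⟨x, hx, rfl⟩ := interior_subset hy
  exact ⟨x, hx, hyD⟩

end Fibres

/-! ### The compact Hausdorff space of regular probability measures. -/

section RegProb

variable {X : Type*} [TopologicalSpace X] [CompactSpace X] [MeasurableSpace X] [BorelSpace X]

theorem _root_.ContinuousMap.integrable_of_compactSpace {E : Type*} [NormedAddCommGroup E]
    (g : C(X, E)) (μ : Measure X) [IsFiniteMeasure μ] : Integrable g μ := by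
  exact g.continuous.integrable_of_hasCompactSupport (HasCompactSupport.of_compactSpace g)

/-- The underlying measure. -/
noncomputable def RegProb.toMeasure {X : Type*} [TopologicalSpace X] [MeasurableSpace X]
    (μ : RegProb X) : Measure X :=
  (show ProbabilityMeasure X from μ.1)

/-- Bundling a regular probability measure. -/
noncomputable def RegProb.mk {X : Type*} [TopologicalSpace X] [MeasurableSpace X]
    (μ : Measure X) (hμ : IsProbabilityMeasure μ) (h : μ.Regular) : RegProb X :=
  ⟨⟨μ, hμ⟩, h⟩

instance RegProb.instIsProbabilityMeasure {X : Type*} [TopologicalSpace X] [MeasurableSpace X]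
    (μ : RegProb X) : IsProbabilityMeasure μ.toMeasure :=
  (show ProbabilityMeasure X from μ.1).2

instance RegProb.instRegular {X : Type*} [TopologicalSpace X] [MeasurableSpace X]
    (μ : RegProb X) : μ.toMeasure.Regular :=
  μ.2

theorem RegProb.tendsto_iff {α : Type*} {F : Filter α} {u : α → RegProb X} {μ : RegProb X} :
    Tendsto u F (𝓝 μ) ↔ ∀ g : C(X, ℝ),
      Tendsto (fun i => ∫ x, g x ∂(u i).toMeasure) F (𝓝 (∫ x, g x ∂μ.toMeasure)) := by
  rw [nhds_induced, tendsto_comap_iff, ProbabilityMeasure.tendsto_iff_forall_integral_tendsto]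
  exact ⟨fun h g => h (BoundedContinuousFunction.mkOfCompact g), fun h g => h g.toContinuousMap⟩

theorem RegProb.continuous_integral (g : C(X, ℝ)) :
    Continuous fun μ : RegProb X => ∫ x, g x ∂μ.toMeasure :=
  continuous_iff_continuousAt.2 fun _ => RegProb.tendsto_iff.1 tendsto_id g

theorem RegProb.isInducing_integral :
    IsInducing fun (μ : RegProb X) (g : C(X, ℝ)) => ∫ x, g x ∂μ.toMeasure := by
  refine isInducing_iff_nhds.2 fun μ => le_antisymm ?_ ?_
  · exact ((continuous_pi RegProb.continuous_integral).tendsto μ).le_comap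
  · refine tendsto_id'.1 (RegProb.tendsto_iff.2 fun g => ?_)
    exact ((continuous_apply (A := fun _ : C(X, ℝ) => ℝ) g).tendsto _).comp tendsto_comap

variable [T2Space X] in
theorem RegProb.ext_integral {μ ν : RegProb X}
    (h : ∀ g : C(X, ℝ), ∫ x, g x ∂μ.toMeasure = ∫ x, g x ∂ν.toMeasure) : μ = ν := by
  have hμν : μ.toMeasure = ν.toMeasure :=
    Measure.ext_of_integral_eq_on_compactlySupported fun g => h g.toContinuousMap
  exact Subtype.ext (Subtype.ext hμν)

variable [T2Space X] in
instance RegProb.instT2Space : T2Space (RegProb X) :=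
  T2Space.of_injective_continuous (fun _ _ h => RegProb.ext_integral fun g => congrFun h g)
    RegProb.isInducing_integral.continuous

variable [T2Space X] in
instance RegProb.instCompactSpace : CompactSpace (RegProb X) := by
  refine ⟨isCompact_iff_ultrafilter_le_nhds.2 fun F _ => ?_⟩
  obtain ⟨P, -, hP⟩ := isCompact_iff_ultrafilter_le_nhds.1
    (isCompact_univ (X := ProbabilityMeasure X)) (F.map fun μ => μ.1) (by simp)
  -- The limit `P` need not be regular; a regular measure with the same integrals replaces it.
  obtain ⟨ν, hreg, -, hν⟩ := Measure.exists_regular_eq_of_compactSpace (P : Measure X)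
  have hprob : IsProbabilityMeasure ν := by
    have h := hν (BoundedContinuousFunction.const X 1)
    simp only [BoundedContinuousFunction.const_apply, integral_const, smul_eq_mul, mul_one,
      probReal_univ] at h
    exact ⟨by rw [← ENNReal.toReal_eq_one_iff]; exact h.symm⟩
  refine ⟨RegProb.mk ν hprob hreg, mem_univ _, ?_⟩
  refine tendsto_id'.1 (RegProb.tendsto_iff.2 fun g => ?_)
  have h := ProbabilityMeasure.tendsto_iff_forall_integral_tendsto.1
    (show Tendsto (fun μ : RegProb X => μ.1) F (𝓝 P) from hP)
    (BoundedContinuousFunction.mkOfCompact g)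
  rw [hν] at h
  exact h

theorem RegProb.integral_apply {ι : Type*} [Fintype ι] (g : C(X, ι → ℝ)) (μ : Measure X)
    [IsFiniteMeasure μ] (i : ι) : (∫ x, g x ∂μ) i = ∫ x, g x i ∂μ :=
  eval_integral (f := fun x => g x) (fun i =>
    ContinuousMap.integrable_of_compactSpace ⟨fun x => g x i, by fun_prop⟩ μ) i

theorem RegProb.continuous_integral_pi {ι : Type*} [Fintype ι] (g : C(X, ι → ℝ)) :
    Continuous fun μ : RegProb X => ∫ x, g x ∂μ.toMeasure := by
  refine continuous_pi fun i => ?_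
  simp_rw [RegProb.integral_apply]
  exact RegProb.continuous_integral ⟨fun x => g x i, by fun_prop⟩

/-- Every neighbourhood in `𝔐(X)` contains one given by finitely many test functions, gathered
into one vector-valued function. -/
theorem RegProb.exists_integral_dist_lt_subset {μ : RegProb X} {U : Set (RegProb X)}
    (hU : U ∈ 𝓝 μ) : ∃ (I : Finset C(X, ℝ)) (g : C(X, I → ℝ)) (ε : ℝ), 0 < ε ∧
      ∀ μ' : RegProb X, dist (∫ x, g x ∂μ'.toMeasure) (∫ x, g x ∂μ.toMeasure) < ε →
        μ' ∈ U := by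
  rw [RegProb.isInducing_integral.nhds_eq_comap, mem_comap] at hU
  obtain ⟨V, hV, hVU⟩ := hU
  rw [nhds_pi, Filter.mem_pi'] at hV
  obtain ⟨I, t, ht, htV⟩ := hV
  have hε : ∀ i : C(X, ℝ), ∃ ε > 0, Metric.ball (∫ x, i x ∂μ.toMeasure) ε ⊆ t i :=
    fun i => Metric.mem_nhds_iff.1 (ht i)
  choose e he het using hε
  obtain ⟨ε, hε, hεe⟩ : ∃ ε > 0, ∀ i ∈ I, ε ≤ e i := by
    rcases I.eq_empty_or_nonempty with rfl | hI
    · exact ⟨1, one_pos, by simp⟩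
    · exact ⟨I.inf' hI e, (Finset.lt_inf'_iff hI).2 fun i _ => he i,
        fun i hi => Finset.inf'_le _ hi⟩
  refine ⟨I, ⟨fun x i => i.1 x, by fun_prop⟩, ε, hε, fun μ' h => hVU (htV fun i hi => het i ?_)⟩
  have h2 := (dist_le_pi_dist _ _ (⟨i, hi⟩ : I)).trans_lt (h.trans_le (hεe i hi))
  rwa [RegProb.integral_apply, RegProb.integral_apply] at h2

end RegProb

/-! ### Finitely supported measures and their density. -/

section FiniteSupport

variable {X : Type*} [TopologicalSpace X] [CompactSpace X] [T2Space X] [MeasurableSpace X]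
  [BorelSpace X]

/-- `μ` is carried by a finite subset of `D`. -/
def FinitelySupportedOn (D : Set X) (μ : RegProb X) : Prop :=
  ∃ T : Finset X, ↑T ⊆ D ∧ μ.toMeasure (↑T)ᶜ = 0

theorem integral_eq_sum_of_compl_null {E : Type*} [NormedAddCommGroup E] [NormedSpace ℝ E]
    [CompleteSpace E] {μ : Measure X} [IsFiniteMeasure μ] {T : Finset X} (hT : μ (↑T)ᶜ = 0)
    (g : C(X, E)) : ∫ x, g x ∂μ = ∑ x ∈ T, μ.real {x} • g x := by
  have hμ : μ.restrict (T : Set X) = μ := Measure.restrict_eq_self_of_ae_mem (by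
    rw [ae_iff]; exact hT)
  rw [← setIntegral_finset _ (g.integrable_of_compactSpace μ).integrableOn, hμ]

theorem sum_measureReal_singleton_eq_one {μ : Measure X} [IsProbabilityMeasure μ] {T : Finset X}
    (hT : μ (↑T)ᶜ = 0) : ∑ x ∈ T, μ.real {x} = 1 := by
  simpa using (integral_eq_sum_of_compl_null hT (ContinuousMap.const X (1 : ℝ))).symm

theorem RegProb.innerRegular (μ : RegProb X) : μ.toMeasure.InnerRegular :=
  inferInstance

/-- Convex combinations in `𝔐(X)`. -/
theorem RegProb.exists_sum_smul {ι : Type*} (s : Finset ι) (w : ι → ℝ) (hw : ∀ i ∈ s, 0 ≤ w i)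
    (hw1 : ∑ i ∈ s, w i = 1) (ρ : ι → RegProb X) : ∃ μ : RegProb X,
      μ.toMeasure = ∑ i ∈ s, ENNReal.ofReal (w i) • (ρ i).toMeasure := by
  have hi : ∀ i, (ρ i).toMeasure.InnerRegular := fun i => (ρ i).innerRegular
  have hp : IsProbabilityMeasure
      (∑ i ∈ s, ENNReal.ofReal (w i) • (ρ i).toMeasure) := by
    refine ⟨?_⟩
    simp only [Measure.coe_finsetSum, Finset.sum_apply, Measure.smul_apply, measure_univ,
      smul_eq_mul, mul_one]
    rw [← ENNReal.ofReal_sum_of_nonneg hw, hw1, ENNReal.ofReal_one]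
  exact ⟨RegProb.mk _ hp inferInstance, rfl⟩

theorem integral_sum_smul {E : Type*} [NormedAddCommGroup E] [NormedSpace ℝ E]
    {ι : Type*} {s : Finset ι} {w : ι → ℝ} (hw : ∀ i ∈ s, 0 ≤ w i)
    (ρ : ι → Measure X) [∀ i, IsFiniteMeasure (ρ i)] (g : C(X, E)) :
    ∫ x, g x ∂(∑ i ∈ s, ENNReal.ofReal (w i) • ρ i) = ∑ i ∈ s, w i • ∫ x, g x ∂(ρ i) := by
  rw [integral_finsetSum_measure fun i _ =>
    (g.integrable_of_compactSpace _).smul_measure ENNReal.ofReal_ne_top]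
  refine Finset.sum_congr rfl fun i hi => ?_
  rw [integral_smul_measure, ENNReal.toReal_ofReal (hw i hi)]

/-- The Dirac measure as an element of `𝔐(X)`. -/
noncomputable def RegProb.dirac (x : X) : RegProb X :=
  RegProb.mk (Measure.dirac x) inferInstance <| by
    have h : (Measure.dirac x).InnerRegular := by
      refine ⟨fun U hU r hr => ?_⟩
      by_cases hx : x ∈ U
      · refine ⟨{x}, by simpa using hx, isCompact_singleton, hr.trans_le ?_⟩
        exact prob_le_one.trans_eq (by simp)
      · rw [Measure.dirac_apply' _ hU, indicator_of_notMem hx] at hr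
        simp at hr
    infer_instance

theorem RegProb.toMeasure_dirac (x : X) : (RegProb.dirac x).toMeasure = Measure.dirac x := rfl

theorem exists_finitelySupportedOn_integral_eq {E : Type*} [NormedAddCommGroup E] [NormedSpace ℝ E]
    [CompleteSpace E] {g : C(X, E)} {S : Set X} {m : E} (hm : m ∈ convexHull ℝ (g '' S)) :
    ∃ μ : RegProb X, FinitelySupportedOn S μ ∧ ∫ x, g x ∂μ.toMeasure = m := by
  classical
  obtain ⟨ι, _, w, z, hw, hw1, hz, rfl⟩ := mem_convexHull_iff_exists_fintype.1 hm
  choose x hxS hxz using hz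
  obtain ⟨μ, hμ⟩ := RegProb.exists_sum_smul Finset.univ w (fun i _ => hw i) hw1
    fun i => RegProb.dirac (x i)
  refine ⟨μ, ⟨Finset.univ.image x, by simpa [range_subset_iff] using hxS, ?_⟩, ?_⟩
  · rw [hμ]
    simp [RegProb.toMeasure_dirac]
  · rw [hμ, integral_sum_smul (fun i _ => hw i)]
    simp [RegProb.toMeasure_dirac, hxz]

/-- The integral of `g` lies in the closed convex hull of `g '' D`, and points of the hull itself
are integrals against finite combinations of Dirac measures on `D`. -/
theorem dense_finitelySupportedOn {D : Set X} (hD : Dense D) :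
    Dense {μ : RegProb X | FinitelySupportedOn D μ} := by
  intro μ
  rw [mem_closure_iff_nhds]
  intro U hU
  obtain ⟨I, g, ε, hε, hg⟩ := RegProb.exists_integral_dist_lt_subset hU
  have hmem : ∫ x, g x ∂μ.toMeasure ∈ closure (convexHull ℝ (g '' D)) := by
    refine (convex_convexHull ℝ _).closure.integral_mem isClosed_closure
      (Eventually.of_forall fun x => ?_) (g.integrable_of_compactSpace _)
    exact closure_mono (subset_convexHull ℝ _)
      (image_closure_subset_closure_image g.continuous ⟨x, hD x, rfl⟩)
  obtain ⟨m, hm, hd⟩ := Metric.mem_closure_iff.1 hmem ε hε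
  obtain ⟨μ', hμ', rfl⟩ := exists_finitelySupportedOn_integral_eq hm
  exact ⟨μ', hg μ' (by rwa [dist_comm]), hμ'⟩

end FiniteSupport

/-! ### The induced map: continuity, gluing, surjectivity. -/

section Pushforward

variable {X Y : Type*}
  [TopologicalSpace X] [CompactSpace X] [T2Space X] [MeasurableSpace X] [BorelSpace X]
  [TopologicalSpace Y] [CompactSpace Y] [T2Space Y] [MeasurableSpace Y] [BorelSpace Y]
  {f : X → Y} (hf : Continuous f)

theorem toMeasure_pushforward (μ : RegProb X) :
    (pushforward f hf μ).toMeasure = μ.toMeasure.map f := rfl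

theorem continuous_pushforward : Continuous (pushforward f hf) := by
  refine continuous_iff_continuousAt.2 fun μ => RegProb.tendsto_iff.2 fun g => ?_
  simp_rw [toMeasure_pushforward]
  have h : ∀ μ : RegProb X, ∫ y, g y ∂(μ.toMeasure.map f) = ∫ x, g (f x) ∂μ.toMeasure :=
    fun μ => integral_map hf.aemeasurable g.continuous.aestronglyMeasurable
  simp_rw [h]
  exact (RegProb.continuous_integral (g.comp ⟨f, hf⟩)).continuousAt

/-- Gluing measures on the fibres along a finitely supported measure on the base. -/
theorem exists_pushforward_eq_of_compl_null {ν : RegProb Y} {T : Finset Y}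
    (hT : ν.toMeasure (↑T)ᶜ = 0) {ρ : Y → RegProb X}
    (hρ : ∀ y, (ρ y).toMeasure (f ⁻¹' {y})ᶜ = 0) :
    ∃ μ : RegProb X, pushforward f hf μ = ν ∧
      μ.toMeasure =
        ∑ y ∈ T, ENNReal.ofReal (ν.toMeasure.real {y}) • (ρ y).toMeasure := by
  obtain ⟨μ, hμ⟩ := RegProb.exists_sum_smul T (fun y => ν.toMeasure.real {y})
    (fun _ _ => measureReal_nonneg) (sum_measureReal_singleton_eq_one hT) ρ
  refine ⟨μ, RegProb.ext_integral fun g => ?_, hμ⟩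
  rw [toMeasure_pushforward, integral_map hf.aemeasurable g.continuous.aestronglyMeasurable, hμ]
  refine (integral_sum_smul (fun _ _ => measureReal_nonneg) (fun y => (ρ y).toMeasure)
    (g.comp ⟨f, hf⟩)).trans ?_
  rw [integral_eq_sum_of_compl_null hT]
  refine Finset.sum_congr rfl fun y _ => ?_
  have h : (fun x => g.comp ⟨f, hf⟩ x) =ᵐ[(ρ y).toMeasure] fun _ => g y := by
    have : ∀ᵐ x ∂(ρ y).toMeasure, x ∈ f ⁻¹' {y} := by rw [ae_iff]; exact hρ y
    filter_upwards [this] with x hx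
    exact congrArg g hx
  rw [integral_congr_ae h]
  simp

theorem FinitelySupportedOn.pushforward {D : Set Y} {μ : RegProb X}
    (h : FinitelySupportedOn (f ⁻¹' D) μ) : FinitelySupportedOn D (pushforward f hf μ) := by
  classical
  obtain ⟨T, hTD, hT⟩ := h
  refine ⟨T.image f, by simpa using hTD, ?_⟩
  rw [toMeasure_pushforward, Measure.map_apply hf.measurable (Finset.measurableSet _).compl]
  refine measure_mono_null (compl_subset_compl.2 fun x hx => ?_) hT
  exact Finset.mem_coe.2 (Finset.mem_image_of_mem f hx)

theorem surjective_pushforward (hs : Function.Surjective f) :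
    Function.Surjective (pushforward f hf) := by
  -- The range is closed, so it suffices to lift finitely supported measures, by Dirac measures at
  -- chosen preimages.
  have hcl : IsClosed (range (pushforward f hf)) :=
    (isCompact_range (continuous_pushforward hf)).isClosed
  refine fun ν => hcl.closure_subset_iff.2 ?_ (dense_finitelySupportedOn dense_univ ν)
  rintro ν ⟨T, -, hT⟩
  choose s hs using hs
  obtain ⟨μ, hμ, -⟩ := exists_pushforward_eq_of_compl_null hf hT
    (ρ := fun y => RegProb.dirac (s y)) fun y => by
      rw [RegProb.toMeasure_dirac, Measure.dirac_apply'
        _ ((measurableSet_singleton y).preimage hf.measurable).compl]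
      simp [hs]
  exact ⟨μ, hμ⟩

end Pushforward

/-! ### Fibre-openness of the induced map. -/

section FibreOpen

theorem FibreOpenAt.eventually_exists_mem_convexHull {X Y E : Type*} [TopologicalSpace X]
    [TopologicalSpace Y] [NormedAddCommGroup E] [NormedSpace ℝ E] {f : X → Y} {y : Y}
    (h : FibreOpenAt f y) (g : C(X, E)) {m : E} (hm : m ∈ convexHull ℝ (g '' (f ⁻¹' {y})))
    {ε : ℝ} (hε : 0 < ε) :
    ∀ᶠ z in 𝓝 y, ∃ m' ∈ convexHull ℝ (g '' (f ⁻¹' {z})), ‖m' - m‖ ≤ ε := by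
  obtain ⟨ι, _, w, z, hw, hw1, hz, rfl⟩ := mem_convexHull_iff_exists_fintype.1 hm
  choose x hx hxz using hz
  have hev : ∀ i, ∀ᶠ z' in 𝓝 y, ∃ x', f x' = z' ∧ ‖g x' - z i‖ ≤ ε := by
    intro i
    have hU : IsOpen (g ⁻¹' Metric.ball (z i) ε) := Metric.isOpen_ball.preimage g.continuous
    filter_upwards [h _ hU ⟨x i, hx i, by simp [hxz, hε]⟩]
    rintro _ ⟨x', hx', rfl⟩
    exact ⟨x', rfl, (mem_ball_iff_norm.1 hx').le⟩
  filter_upwards [eventually_all.2 hev] with z' hz'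
  choose x' hx' hd using hz'
  refine ⟨∑ i, w i • g (x' i), mem_convexHull_of_exists_fintype w (fun i => g (x' i)) hw hw1
    (fun i => ⟨x' i, hx' i, rfl⟩) rfl, ?_⟩
  calc ‖∑ i, w i • g (x' i) - ∑ i, w i • z i‖ = ‖∑ i, w i • (g (x' i) - z i)‖ := by
        simp [smul_sub]
    _ ≤ ∑ i, w i * ε := norm_sum_le_of_le _ fun i _ => by
        rw [norm_smul, Real.norm_of_nonneg (hw i)]
        exact mul_le_mul_of_nonneg_left (hd i) (hw i)
    _ = ε := by rw [← Finset.sum_mul, hw1, one_mul]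

variable {X Y : Type*}
  [TopologicalSpace X] [CompactSpace X] [T2Space X] [MeasurableSpace X] [BorelSpace X]
  [TopologicalSpace Y] [CompactSpace Y] [T2Space Y] [MeasurableSpace Y] [BorelSpace Y]
  {f : X → Y}

theorem exists_norm_setIntegral_sub_le {E : Type*} [NormedAddCommGroup E] [NormedSpace ℝ E]
    [CompleteSpace E] (μ : Measure X) [IsFiniteMeasure μ] (g : C(X, E)) {S : Set X}
    (hS : MeasurableSet S) (hne : S.Nonempty) {ε : ℝ} (hε : 0 < ε) :
    ∃ m ∈ convexHull ℝ (g '' S), ‖∫ x in S, g x ∂μ - μ.real S • m‖ ≤ μ.real S * ε := by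
  by_cases h0 : μ S = 0
  -- On a null set both sides vanish, so any value of `g` on `S` serves.
  · obtain ⟨x, hx⟩ := hne
    refine ⟨g x, subset_convexHull ℝ _ ⟨x, hx, rfl⟩, ?_⟩
    simp [Measure.real, h0, setIntegral_measure_zero]
  · have hmem : ⨍ x in S, g x ∂μ ∈ closure (convexHull ℝ (g '' S)) :=
      (convex_convexHull ℝ _).set_average_mem_closure h0 (measure_ne_top μ S)
        ((ae_restrict_iff' hS).2 (Eventually.of_forall fun x hx =>
          subset_convexHull ℝ _ ⟨x, hx, rfl⟩))
        (g.integrable_of_compactSpace μ).integrableOn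
    obtain ⟨m, hm, hd⟩ := Metric.mem_closure_iff.1 hmem ε hε
    refine ⟨m, hm, ?_⟩
    rw [← measure_smul_setAverage g (measure_ne_top μ S), ← smul_sub, norm_smul,
      Real.norm_of_nonneg measureReal_nonneg]
    exact mul_le_mul_of_nonneg_left (by simpa [dist_eq_norm] using hd.le) measureReal_nonneg

theorem exists_norm_integral_sub_sum_le {E : Type*} [NormedAddCommGroup E] [NormedSpace ℝ E]
    [CompleteSpace E] (hf : Continuous f) (hs : Function.Surjective f) {μ : RegProb X}
    {T : Finset Y} (hT : (pushforward f hf μ).toMeasure (↑T)ᶜ = 0) (g : C(X, E))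
    {ε : ℝ} (hε : 0 < ε) : ∃ m : Y → E, (∀ y, m y ∈ convexHull ℝ (g '' (f ⁻¹' {y}))) ∧
      ‖∫ x, g x ∂μ.toMeasure -
        ∑ y ∈ T, (pushforward f hf μ).toMeasure.real {y} • m y‖ ≤ ε := by
  have hmeas : ∀ y, MeasurableSet (f ⁻¹' {y}) := fun y =>
    (measurableSet_singleton y).preimage hf.measurable
  choose m hm hd using fun y =>
    exists_norm_setIntegral_sub_le μ.toMeasure g (hmeas y) (hs y) hε
  refine ⟨m, hm, ?_⟩
  have hreal : ∀ y, (pushforward f hf μ).toMeasure.real {y} =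
      μ.toMeasure.real (f ⁻¹' {y}) := fun y => by
    rw [toMeasure_pushforward, map_measureReal_apply hf.measurable (measurableSet_singleton y)]
  have hsum := sum_measureReal_singleton_eq_one hT
  rw [toMeasure_pushforward, Measure.map_apply hf.measurable (Finset.measurableSet _).compl] at hT
  have hint : ∫ x, g x ∂μ.toMeasure = ∑ y ∈ T, ∫ x in f ⁻¹' {y}, g x ∂μ.toMeasure := by
    rw [← integral_biUnion_finset T (fun y _ => hmeas y)
      (fun y _ z _ hyz => Disjoint.preimage f (disjoint_singleton.2 hyz))
      fun y _ => (g.integrable_of_compactSpace _).integrableOn]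
    rw [Measure.restrict_eq_self_of_ae_mem]
    rw [ae_iff]
    refine measure_mono_null (fun x hx => ?_) hT
    simpa using hx
  simp_rw [hreal] at hsum ⊢
  rw [hint, ← Finset.sum_sub_distrib]
  calc _ ≤ ∑ y ∈ T, μ.toMeasure.real (f ⁻¹' {y}) * ε :=
        norm_sum_le_of_le _ fun y _ => hd y
    _ = ε := by rw [← Finset.sum_mul, hsum, one_mul]

/-- A choice of values on a finite set that can be followed along nearby fibres extends to a
continuous function that approximates some selection of `Φ`, up to a continuous error vanishing on
the finite set. -/
theorem exists_continuous_approx_selection {ι : Type*} [Fintype ι] {Φ : Y → Set (ι → ℝ)}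
    (hne : ∀ y, (Φ y).Nonempty) {C : ℝ} (hC : ∀ y, ∀ m ∈ Φ y, ‖m‖ ≤ C) {T : Finset Y}
    {m : Y → ι → ℝ} (hm : ∀ y ∈ T, ∀ ε > 0, ∀ᶠ z in 𝓝 y, ∃ m' ∈ Φ z, ‖m' - m y‖ ≤ ε)
    {ε : ℝ} (hε : 0 < ε) : ∃ (h : C(Y, ι → ℝ)) (q : C(Y, ℝ)) (p : Y → ι → ℝ),
      (∀ y ∈ T, h y = m y) ∧ (∀ y ∈ T, q y = 0) ∧ (∀ y, p y ∈ Φ y) ∧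
        ∀ y, ‖p y - h y‖ ≤ ε + q y := by
  have hTc : IsClosed (T : Set Y) := T.finite_toSet.isClosed
  obtain ⟨h, hh⟩ := ContinuousMap.exists_restrict_eq hTc
    (⟨fun y => m y, continuous_of_discreteTopology⟩ : C((T : Set Y), ι → ℝ))
  have hhT : ∀ y ∈ T, h y = m y := fun y hy => congrArg (fun k => k ⟨y, hy⟩) hh
  have hev : ∀ y ∈ T, ∀ᶠ z in 𝓝 y, ∃ m' ∈ Φ z, ‖m' - h z‖ ≤ ε := by
    intro y hy
    have h1 : ∀ᶠ z in 𝓝 y, ‖h z - h y‖ < ε / 2 := by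
      have := h.continuous.continuousAt.eventually (Metric.ball_mem_nhds (h y) (half_pos hε))
      filter_upwards [this] with z hz using mem_ball_iff_norm.1 hz
    filter_upwards [h1, hm y hy (ε / 2) (half_pos hε)] with z hz ⟨m', hm', hd⟩
    refine ⟨m', hm', ?_⟩
    rw [← hhT y hy] at hd
    have := norm_sub_le_norm_sub_add_norm_sub m' (h y) (h z)
    rw [norm_sub_rev (h y)] at this
    linarith
  set V : Set Y := interior {z | ∃ m' ∈ Φ z, ‖m' - h z‖ ≤ ε} with hV
  have hTV : Disjoint (T : Set Y) Vᶜ :=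
    disjoint_compl_right_iff_subset.2 fun y hy => mem_interior_iff_mem_nhds.2 (hev y hy)
  -- The cutoff `k` is `1` off `V`, where `h` cannot be followed and only the crude bound `C + ‖h
  -- y‖` is available; their product is the error `q`.
  obtain ⟨k, hk0, hk1, hk⟩ := exists_continuous_zero_one_of_isClosed hTc
    isOpen_interior.isClosed_compl hTV
  have hp : ∀ z, ∃ m' ∈ Φ z, z ∈ V → ‖m' - h z‖ ≤ ε := by
    intro z
    by_cases hz : z ∈ V
    · obtain ⟨m', hm', hd⟩ := interior_subset hz
      exact ⟨m', hm', fun _ => hd⟩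
    · obtain ⟨m', hm'⟩ := hne z
      exact ⟨m', hm', fun h => absurd h hz⟩
  choose p hpΦ hpd using hp
  refine ⟨h, ⟨fun y => k y * (C + ‖h y‖), by fun_prop⟩, p, hhT, fun y hy => ?_, hpΦ, fun y => ?_⟩
  · simp [show k y = 0 from hk0 hy]
  · have hCh : 0 ≤ C + ‖h y‖ :=
      add_nonneg ((norm_nonneg _).trans (hC y _ (hpΦ y))) (norm_nonneg _)
    change _ ≤ ε + k y * (C + ‖h y‖)
    by_cases hy : y ∈ V
    · have := mul_nonneg (hk y).1 hCh
      linarith [hpd y hy]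
    · rw [show k y = 1 from hk1 hy]
      linarith [norm_sub_le (p y) (h y), hC y _ (hpΦ y)]

/-- If `f` is fibre-open at each point of a finite set carrying `ν`, then `f_*` is fibre-open at
`ν`. -/
theorem fibreOpenAt_pushforward (hf : Continuous f) (hs : Function.Surjective f) {D : Set Y}
    (hD : ∀ y ∈ D, FibreOpenAt f y) {ν : RegProb Y} (hν : FinitelySupportedOn D ν) :
    FibreOpenAt (pushforward f hf) ν := by
  rintro U hU ⟨μ, rfl, hμU⟩
  obtain ⟨T, hTD, hT⟩ := hν
  obtain ⟨K, hK, hKc, hKU⟩ := exists_mem_nhds_isClosed_subset (hU.mem_nhds hμU)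
  obtain ⟨I, g, δ, hδ, hg⟩ := RegProb.exists_integral_dist_lt_subset hK
  -- One `ε` goes to the means over `ν`, one to the change of `∫ h`, and two to `ε + ∫ q` for the
  -- glued measure.
  obtain ⟨ε, hε, hεδ⟩ : ∃ ε > 0, 4 * ε < δ := ⟨δ / 5, by positivity, by linarith⟩
  obtain ⟨m, hm, hmd⟩ := exists_norm_integral_sub_sum_le hf hs hT g hε
  obtain ⟨C, hC⟩ : ∃ C, ∀ x, ‖g x‖ ≤ C := ⟨‖g‖, g.norm_coe_le_norm⟩
  obtain ⟨h, q, p, hhT, hqT, hp, hpd⟩ := exists_continuous_approx_selection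
    (Φ := fun y => convexHull ℝ (g '' (f ⁻¹' {y}))) (C := C) (T := T) (m := m)
    (fun y => ⟨m y, hm y⟩)
    (fun y m hm => by
      have hsub : g '' (f ⁻¹' {y}) ⊆ Metric.closedBall 0 C := by
        rintro _ ⟨x, -, rfl⟩
        simpa using hC x
      simpa using convexHull_min hsub (convex_closedBall _ _) hm)
    (fun y hy η hη => (hD y (hTD hy)).eventually_exists_mem_convexHull g (hm y) hη) hε
  choose ρ hρ hρp using fun y => exists_finitelySupportedOn_integral_eq (hp y)
  have hρ0 : ∀ y, (ρ y).toMeasure (f ⁻¹' {y})ᶜ = 0 := fun y => by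
    obtain ⟨S, hS, hS0⟩ := hρ y
    exact measure_mono_null (compl_subset_compl.2 hS) hS0
  set ν := pushforward f hf μ with hνdef
  set W : Set (RegProb Y) :=
    {ν' | dist (∫ y, h y ∂ν'.toMeasure) (∫ y, h y ∂ν.toMeasure) < ε} ∩
      {ν' | ∫ y, q y ∂ν'.toMeasure < ε} with hW
  have hWo : IsOpen W :=
    (isOpen_lt ((RegProb.continuous_integral_pi h).dist continuous_const) continuous_const).inter
      (isOpen_lt (RegProb.continuous_integral q) continuous_const)
  have hνW : ν ∈ W := by
    refine ⟨by simpa using hε, ?_⟩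
    change ∫ y, q y ∂ν.toMeasure < ε
    rw [integral_eq_sum_of_compl_null hT, Finset.sum_eq_zero fun y hy => by simp [hqT y hy]]
    exact hε
  have hWK : W ∩ {ν' | FinitelySupportedOn univ ν'} ⊆ pushforward f hf '' K := by
    rintro ν' ⟨⟨hν'1, hν'2⟩, T', -, hT'⟩
    obtain ⟨μ', hμ', hμ'sum⟩ := exists_pushforward_eq_of_compl_null hf hT' hρ0
    refine ⟨μ', hg μ' ?_, hμ'⟩
    have h1 : ‖∫ x, g x ∂μ'.toMeasure - ∫ y, h y ∂ν'.toMeasure‖ ≤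
        ε + ∫ y, q y ∂ν'.toMeasure := by
      rw [hμ'sum, integral_sum_smul (fun _ _ => measureReal_nonneg)
        (fun y => (ρ y).toMeasure), integral_eq_sum_of_compl_null hT' h,
        integral_eq_sum_of_compl_null hT' q, ← Finset.sum_sub_distrib]
      calc _ ≤ ∑ y ∈ T', ν'.toMeasure.real {y} * (ε + q y) :=
            norm_sum_le_of_le _ fun y _ => by
              rw [← smul_sub, norm_smul, Real.norm_of_nonneg measureReal_nonneg, hρp]
              exact mul_le_mul_of_nonneg_left (hpd y) measureReal_nonneg
        _ = _ := by
            simp_rw [mul_add, Finset.sum_add_distrib, ← Finset.sum_mul,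
              sum_measureReal_singleton_eq_one hT', one_mul, smul_eq_mul]
    have h3 : ‖∫ y, h y ∂ν.toMeasure - ∫ x, g x ∂μ.toMeasure‖ ≤ ε := by
      rw [norm_sub_rev, integral_eq_sum_of_compl_null hT,
        Finset.sum_congr rfl fun y hy => by rw [hhT y hy]]
      exact hmd
    rw [← dist_eq_norm] at h1 h3
    have hν'1 : dist (∫ y, h y ∂ν'.toMeasure) (∫ y, h y ∂ν.toMeasure) < ε := hν'1
    have hν'2 : ∫ y, q y ∂ν'.toMeasure < ε := hν'2
    have h4 := dist_triangle4 (∫ x, g x ∂μ'.toMeasure) (∫ y, h y ∂ν'.toMeasure)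
      (∫ y, h y ∂ν.toMeasure) (∫ x, g x ∂μ.toMeasure)
    linarith
  have hKcl : IsClosed (pushforward f hf '' K) :=
    (hKc.isCompact.image (continuous_pushforward hf)).isClosed
  -- Finitely supported measures are dense in the open set `W` and the image of `K` is closed, so it
  -- contains all of `W`.
  refine mem_of_superset (hWo.mem_nhds hνW) (Subset.trans ?_ (image_mono hKU))
  exact ((dense_finitelySupportedOn dense_univ).open_subset_closure_inter hWo).trans
    (hKcl.closure_subset_iff.2 hWK)

theorem DenselyOpen.exists_dense_fibreOpenAt {X Y : Type*} [TopologicalSpace X]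
    [TopologicalSpace Y] {f : X → Y} (h : DenselyOpen f) :
    ∃ D : Set Y, Dense D ∧ ∀ y ∈ D, FibreOpenAt f y := by
  obtain ⟨-, -, F, hF, D, hD, hc⟩ := h
  exact ⟨D, hD, fun y hy => FibreOpenAt.of_continuousAt hF (hc y hy)⟩

theorem DenselyOpen.pushforward (hf : Continuous f) (h : DenselyOpen f) :
    DenselyOpen (pushforward f hf) := by
  obtain ⟨D, hD, ho⟩ := h.exists_dense_fibreOpenAt
  exact denselyOpen_of_dense_fibreOpenAt (continuous_pushforward hf)
    (surjective_pushforward hf h.2.1) (dense_finitelySupportedOn hD)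
    fun ν hν => fibreOpenAt_pushforward hf h.2.1 ho hν

theorem SemiOpen.pushforward (hf : Continuous f) (hso : SemiOpen f) (h : DenselyOpen f) :
    SemiOpen (pushforward f hf) := by
  obtain ⟨D, hD, ho⟩ := h.exists_dense_fibreOpenAt
  intro U hU hne
  obtain ⟨μ, hμU, hμ⟩ :=
    (dense_finitelySupportedOn (hso.dense_preimage hD)).inter_open_nonempty U hU hne
  exact ⟨_, mem_interior_iff_mem_nhds.2
    (fibreOpenAt_pushforward hf h.2.1 ho (hμ.pushforward hf) U hU ⟨μ, rfl, hμU⟩)⟩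

end FibreOpen

end InducedMaps

theorem mainTheorem4 {X Y : Type*}
    [TopologicalSpace X] [CompactSpace X] [T2Space X] [MeasurableSpace X] [BorelSpace X]
    [TopologicalSpace Y] [CompactSpace Y] [T2Space Y] [MeasurableSpace Y] [BorelSpace Y]
    (f : X → Y) (hf : Continuous f) (hsurj : Function.Surjective f) :
    (InducedMaps.SemiOpen f → InducedMaps.DenselyOpen f →
      InducedMaps.SemiOpen (InducedMaps.pushforward f hf) ∧
        InducedMaps.DenselyOpen (InducedMaps.pushforward f hf)) ∧
    (InducedMaps.DenselyOpen f → InducedMaps.DenselyOpen (InducedMaps.pushforward f hf)) :=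
  ⟨fun hso h => ⟨hso.pushforward hf h, h.pushforward hf⟩, fun h => h.pushforward hf⟩
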